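/- There exist universal constants $c_0, c_1, C > 0$ and $s, \psi \in (0,1)$ such that the following holds. Let $m, n$ be non-negative integers with $m > c_0 n$, and let $A \in \mathbb{R}^{m\times n}$ be a random matrix whose entries are independent standard Gaussians $N(0,1)$. Then, with probability at least $1 - C\exp(-c_1 m)$, $$\big\|(|Ax| - |Ay|)_T\big\|_1 \le \psi\, \big\|(|Ax| - |Ay|)_{T^c}\big\|_1 \quad \text{for all } x, y \in \mathbb{R}^n \text{ and all } T \subseteq \{1,\dots,m\} \text{ with } |T| \le sm$$ (that is, $A$ satisfies the 1-Absolute Range Property of order $sm$ for $\psi$). Here $|v|$ is the componentwise absolute value of a vector $v\in\mathbb{R}^m$, $v_T \in \mathbb{R}^m$ has $i$-th entry $v_i$ if $i \in T$ and $0$ otherwise, and $T^c=\{1,\dots,m\}\setminus T$. Consequently, the property holds with high probability for $m$ sufficiently large: with the same constants, for every $\delta > 0$ there is an $M$ such that for all $m \ge M$ and all $n$ with $m > c_0 n$, the property holds with probability at least $1-\delta$. -/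

import Mathlib

open MeasureTheory ProbabilityTheory

universe u

noncomputable section

namespace RobustPhaseRetrieval

/-- The `ℓ₁` norm of a vector `v ∈ ℝᵐ`. -/
def l1Norm {m : ℕ} (v : Fin m → ℝ) : ℝ := ∑ i, |v i|

/-- The vector `v_T ∈ ℝᵐ`, with `i`-th entry `v i` if `i ∈ T` and `0` otherwise. -/
def restrictTo {m : ℕ} (v : Fin m → ℝ) (T : Finset (Fin m)) : Fin m → ℝ :=
  fun i => if i ∈ T then v i else 0

/-- The vector `|v|ᵖ`, componentwise. -/
def absPow {m : ℕ} (p : ℕ) (v : Fin m → ℝ) : Fin m → ℝ := fun i => |v i| ^ p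

/-- The `p`-Absolute Range Property of order `L` for `ψ` of a real matrix `A`
(used for `p ∈ {1, 2}` and `ψ ∈ (0, 1)`). -/
def AbsoluteRangeProperty {m n : ℕ} (p : ℕ) (A : Matrix (Fin m) (Fin n) ℝ) (L ψ : ℝ) : Prop :=
  ∀ (x y : Fin n → ℝ) (T : Finset (Fin m)), (T.card : ℝ) ≤ L →
    l1Norm (restrictTo (absPow p (A.mulVec x) - absPow p (A.mulVec y)) T) ≤
      ψ * l1Norm (restrictTo (absPow p (A.mulVec x) - absPow p (A.mulVec y)) Tᶜ)

/-- Assumption G: the entries of the random matrix `A` are independent, each with the standard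
normal law `N(0, 1)`. -/
structure AssumptionG {Ω : Type*} [MeasurableSpace Ω] (μ : Measure Ω) {m n : ℕ}
    (A : Ω → Matrix (Fin m) (Fin n) ℝ) : Prop where
  indep : iIndepFun (fun (k : Fin m × Fin n) (ω : Ω) => A ω k.1 k.2) μ
  law : ∀ (i : Fin m) (j : Fin n), HasLaw (fun ω => A ω i j) (gaussianReal 0 1) μ

end RobustPhaseRetrieval

end

namespace RobustPhaseRetrieval

/-! Since `||a| - |b|| = min |a - b| |a + b|`, the quantity to control is `min |(Au)ᵢ| |(Av)ᵢ|` with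
`u = x - y`, `v = x + y`; say `‖u‖ ≤ ‖v‖`. Two uniform facts about `A` then suffice: `‖A‖ ≤ K√m`,
and for every nonzero `w` at most `m/4` coordinates of `Aw` are below `ε‖w‖`. On a small `T`,
Cauchy–Schwarz bounds the sum by `K√s · m‖u‖`. Off `T` and the two sets of small coordinates, at
least `m/4` indices remain, each contributing at least `ε‖u‖`. For small `s` the second sum
dominates (`sum_min_le_of_norm_le`).

For a fixed unit vector, `Av` has independent standard Gaussian entries, so Chernoff bounds make
both facts fail with probability at most `exp(-m)` each. They extend to the whole sphere through a
net of at most `exp(m/2)` points, which is where `m > c₀ n` enters, and a union bound leaves `2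
exp(-m/2)`. -/

/-! ### Chernoff bound and Gaussian exponential moments -/

/-- Markov's inequality for `exp (∑ f (X i))`, whose expectation factors by independence. -/
theorem measure_le_sum_of_iIndepFun {Ω ι : Type*} [MeasurableSpace Ω] [Fintype ι] {μ : Measure Ω}
    {X : ι → Ω → ℝ} {ν : Measure ℝ} (hX : iIndepFun X μ) (hlaw : ∀ i, HasLaw (X i) ν μ)
    {f : ℝ → ℝ} (hf : Measurable f) {B : ℝ} (t : ℝ)
    (hB : ∫⁻ x, ENNReal.ofReal (Real.exp (f x)) ∂ν ≤ ENNReal.ofReal (Real.exp B)) :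
    μ {ω | t ≤ ∑ i, f (X i ω)} ≤ ENNReal.ofReal (Real.exp (Fintype.card ι * B - t)) := by
  have hg : Measurable fun x : ℝ => ENNReal.ofReal (Real.exp (f x)) := by fun_prop
  set g : ℝ → ENNReal := fun x => ENNReal.ofReal (Real.exp (f x)) with hgdef
  have hm : ∀ i, AEMeasurable (X i) μ := fun i => (hlaw i).aemeasurable
  -- `HasLaw` gives only a.e. measurability, while the product formula needs measurable functions.
  set X' : ι → Ω → ℝ := fun i => (hm i).mk
  have hXX' : ∀ i, X i =ᵐ[μ] X' i := fun i => (hm i).ae_eq_mk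
  have hX' : iIndepFun X' μ := (iIndepFun_congr hXX').1 hX
  have hX'm : ∀ i, Measurable (X' i) := fun i => (hm i).measurable_mk
  have hprod : ∫⁻ ω, ∏ i, g (X i ω) ∂μ = ∏ _i : ι, ∫⁻ x, g x ∂ν := by
    have h1 : ∫⁻ ω, ∏ i, g (X i ω) ∂μ = ∫⁻ ω, ∏ i, g (X' i ω) ∂μ := by
      apply lintegral_congr_ae
      filter_upwards [ae_all_iff.2 hXX'] with ω hω
      simp [hω]
    rw [h1]
    have h2 := lintegral_prod_eq_prod_lintegral_of_indepFun Finset.univ (fun i ω => g (X' i ω))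
      (hX'.comp (fun _ => g) (fun _ => hg)) (fun i => hg.comp (hX'm i))
    rw [h2]
    refine Finset.prod_congr rfl fun i _ => ?_
    rw [← (hlaw i).map_eq, lintegral_map' hg.aemeasurable (hm i)]
    exact lintegral_congr_ae ((hXX' i).fun_comp g).symm
  have hset : {ω | t ≤ ∑ i, f (X i ω)} =
      {ω | ENNReal.ofReal (Real.exp t) ≤ ∏ i, g (X i ω)} := by
    ext ω
    simp only [Set.mem_ofPred_eq, hgdef]
    rw [← ENNReal.ofReal_prod_of_nonneg (fun i _ => (Real.exp_pos _).le), ← Real.exp_sum,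
      ENNReal.ofReal_le_ofReal_iff (Real.exp_pos _).le, Real.exp_le_exp]
  have hmarkov := mul_meas_ge_le_lintegral₀ (μ := μ) (f := fun ω => ∏ i, g (X i ω))
    (Finset.aemeasurable_fun_prod _ fun i _ => hg.comp_aemeasurable (hm i))
    (ENNReal.ofReal (Real.exp t))
  rw [← hset, hprod] at hmarkov
  have hle : ∏ _i : ι, ∫⁻ x, g x ∂ν ≤ ENNReal.ofReal (Real.exp (Fintype.card ι * B)) := by
    calc ∏ _i : ι, ∫⁻ x, g x ∂ν ≤ ∏ _i : ι, ENNReal.ofReal (Real.exp B) :=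
          Finset.prod_le_prod' fun _ _ => hB
      _ = _ := by
          rw [Finset.prod_const, Finset.card_univ, ← ENNReal.ofReal_pow (Real.exp_pos _).le,
            ← Real.exp_nat_mul]
  rw [Real.exp_sub, ENNReal.ofReal_div_of_pos (Real.exp_pos _),
    ENNReal.le_div_iff_mul_le (Or.inl (by simp [Real.exp_pos])) (Or.inl ENNReal.ofReal_ne_top),
    mul_comm]
  exact hmarkov.trans hle

theorem lintegral_exp_sq_div_four_gaussianReal_le :
    ∫⁻ x, ENNReal.ofReal (Real.exp (x ^ 2 / 4)) ∂(gaussianReal 0 1) ≤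
      ENNReal.ofReal (Real.exp 1) := by
  rw [gaussianReal_of_var_ne_zero 0 one_ne_zero,
    lintegral_withDensity_eq_lintegral_mul _ (measurable_gaussianPDF 0 1) (by fun_prop)]
  have hpt : ∀ x : ℝ, (gaussianPDF 0 1 * fun x => ENNReal.ofReal (Real.exp (x ^ 2 / 4))) x =
      ENNReal.ofReal ((√(2 * Real.pi))⁻¹ * Real.exp (-(1 / 4) * x ^ 2)) := by
    intro x
    rw [Pi.mul_apply, gaussianPDF, ← ENNReal.ofReal_mul (gaussianPDFReal_nonneg _ _ _),
      gaussianPDFReal, mul_assoc, ← Real.exp_add]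
    congr 3
    · simp
    · push_cast; ring
  simp_rw [hpt]
  rw [← ofReal_integral_eq_lintegral_ofReal
    ((integrable_exp_neg_mul_sq (by norm_num : (0 : ℝ) < 1 / 4)).const_mul _)
    (Filter.Eventually.of_forall fun x => by positivity),
    integral_const_mul, integral_gaussian]
  apply ENNReal.ofReal_le_ofReal
  have hpi := Real.pi_pos
  have h1 : (√(2 * Real.pi))⁻¹ * √(Real.pi / (1 / 4)) = √2 := by
    rw [← Real.sqrt_inv, ← Real.sqrt_mul (by positivity)]
    congr 1
    field_simp
    norm_num
  rw [h1]
  have h2 : √2 ≤ 2 := by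
    rw [Real.sqrt_le_left (by norm_num)]; norm_num
  linarith [Real.add_one_le_exp 1]

theorem gaussianReal_abs_lt_le {t : ℝ} :
    gaussianReal 0 1 {x | |x| < t} ≤ ENNReal.ofReal (2 * t) := by
  rw [gaussianReal_apply 0 one_ne_zero]
  have hset : {x : ℝ | |x| < t} = Set.Ioo (-t) t := by
    ext x; simp [abs_lt]
  calc ∫⁻ x in {x | |x| < t}, gaussianPDF 0 1 x ≤ ∫⁻ _x in {x : ℝ | |x| < t}, 1 := by
        refine lintegral_mono fun x => ?_
        rw [gaussianPDF, ENNReal.ofReal_le_one, gaussianPDFReal]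
        have h1 : (√(2 * Real.pi * ((1 : NNReal) : ℝ)))⁻¹ ≤ 1 := by
          apply inv_le_one_of_one_le₀
          rw [Real.one_le_sqrt]
          push_cast
          linarith [Real.pi_gt_three]
        have h2 : Real.exp (-(x - 0) ^ 2 / (2 * ((1 : NNReal) : ℝ))) ≤ 1 := by
          rw [Real.exp_le_one_iff]
          push_cast
          nlinarith [sq_nonneg x]
        exact mul_le_one₀ h1 (Real.exp_pos _).le h2
    _ = ENNReal.ofReal (2 * t) := by
        rw [setLIntegral_one, hset, Real.volume_Ioo]
        congr 1; ring

/-- The moment is at most `1 + exp a * P(|x| < t)`, hence at most `2 ≤ exp 1`. A large weight `a` is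
affordable when `t` is small enough. -/
theorem lintegral_exp_indicator_gaussianReal_le {a t : ℝ} (h : Real.exp a * (2 * t) ≤ 1) :
    ∫⁻ x, ENNReal.ofReal (Real.exp (if |x| < t then a else 0)) ∂(gaussianReal 0 1) ≤
      ENNReal.ofReal (Real.exp 1) := by
  have hs : MeasurableSet {x : ℝ | |x| < t} := measurableSet_lt (by fun_prop) (by fun_prop)
  calc ∫⁻ x, ENNReal.ofReal (Real.exp (if |x| < t then a else 0)) ∂(gaussianReal 0 1)
      ≤ ∫⁻ x, (1 + Set.indicator {x : ℝ | |x| < t} (fun _ => ENNReal.ofReal (Real.exp a)) x)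
          ∂(gaussianReal 0 1) := by
        refine lintegral_mono fun x => ?_
        by_cases hx : |x| < t <;> simp [hx]
    _ = 1 + ENNReal.ofReal (Real.exp a) * gaussianReal 0 1 {x | |x| < t} := by
        rw [lintegral_add_left measurable_const, lintegral_indicator_const hs]
        simp
    _ ≤ 1 + ENNReal.ofReal (Real.exp a) * ENNReal.ofReal (2 * t) := by
        gcongr; exact gaussianReal_abs_lt_le
    _ = 1 + ENNReal.ofReal (Real.exp a * (2 * t)) := by
        rw [ENNReal.ofReal_mul (Real.exp_pos a).le]
    _ ≤ ENNReal.ofReal (1 + 1) := by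
        rw [ENNReal.ofReal_add zero_le_one zero_le_one, ENNReal.ofReal_one]
        gcongr
        exact ENNReal.ofReal_le_one.2 h
    _ ≤ _ := ENNReal.ofReal_le_ofReal (Real.add_one_le_exp 1)

/-! ### Law of `Au` for a fixed vector `u` -/

section

variable {Ω : Type*} [MeasurableSpace Ω] {μ : Measure Ω} {m n : ℕ}
  {A : Ω → Matrix (Fin m) (Fin n) ℝ}

theorem AssumptionG.hasGaussianLaw (hA : AssumptionG μ A) (i : Fin m) (j : Fin n) :
    HasGaussianLaw (fun ω => A ω i j) μ where
  isGaussian_map := by rw [(hA.law i j).map_eq]; infer_instance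

theorem AssumptionG.covariance_entry (hA : AssumptionG μ A) (i k : Fin m) (j l : Fin n) :
    cov[fun ω => A ω i j, fun ω => A ω k l; μ] = if i = k ∧ j = l then 1 else 0 := by
  have := hA.indep.isProbabilityMeasure
  split_ifs with h
  · obtain ⟨rfl, rfl⟩ := h
    rw [covariance_self (hA.law i j).aemeasurable, (hA.law i j).variance_eq]
    simp
  · refine (hA.indep.indepFun (i := (i, j)) (j := (k, l)) ?_).covariance_eq_zero
      (hA.hasGaussianLaw i j).memLp_two (hA.hasGaussianLaw k l).memLp_two
    simpa using h

theorem AssumptionG.covariance_mulVec (hA : AssumptionG μ A) (u : Fin n → ℝ) (i k : Fin m) :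
    cov[fun ω => (A ω).mulVec u i, fun ω => (A ω).mulVec u k; μ] =
      if i = k then ∑ j, u j ^ 2 else 0 := by
  have := hA.indep.isProbabilityMeasure
  simp only [Matrix.mulVec, dotProduct]
  rw [covariance_fun_sum_fun_sum (fun j => (hA.hasGaussianLaw i j).memLp_two.mul_const _)
    (fun j => (hA.hasGaussianLaw k j).memLp_two.mul_const _)]
  simp only [covariance_mul_const_left, covariance_mul_const_right, hA.covariance_entry]
  by_cases h : i = k <;> simp [h, sq]

theorem AssumptionG.hasGaussianLaw_mulVec (hA : AssumptionG μ A) (u : Fin n → ℝ) :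
    HasGaussianLaw (fun ω => (A ω).mulVec u) μ := by
  have h := hA.indep.hasGaussianLaw fun k : Fin m × Fin n => hA.hasGaussianLaw k.1 k.2
  let L : (Fin m × Fin n → ℝ) →L[ℝ] (Fin m → ℝ) :=
    LinearMap.toContinuousLinearMap
      { toFun := fun x i => ∑ j, x (i, j) * u j
        map_add' := fun x y => by ext; simp [add_mul, Finset.sum_add_distrib]
        map_smul' := fun c x => by ext; simp [Finset.mul_sum, mul_assoc] }
  exact h.map L

/-- The entries of `Au` are jointly Gaussian and uncorrelated, hence independent. -/
theorem AssumptionG.iIndepFun_mulVec (hA : AssumptionG μ A) (u : Fin n → ℝ) :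
    iIndepFun (fun i ω => (A ω).mulVec u i) μ :=
  (hA.hasGaussianLaw_mulVec u).iIndepFun_of_covariance_eq_zero fun i j hij => by
    rw [hA.covariance_mulVec, if_neg hij]

theorem AssumptionG.hasLaw_mulVec (hA : AssumptionG μ A) {u : Fin n → ℝ}
    (hu : ∑ j, u j ^ 2 = 1) (i : Fin m) :
    HasLaw (fun ω => (A ω).mulVec u i) (gaussianReal 0 1) μ where
  aemeasurable := ((hA.hasGaussianLaw_mulVec u).eval i).aemeasurable
  map_eq := by
    have := hA.indep.isProbabilityMeasure
    have hg := (hA.hasGaussianLaw_mulVec u).eval i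
    rw [hg.map_eq_gaussianReal, ← covariance_self hg.aemeasurable, hA.covariance_mulVec, hu]
    have hmean : ∫ ω, (A ω).mulVec u i ∂μ = 0 := by
      simp only [Matrix.mulVec, dotProduct]
      rw [integral_finsetSum _ fun j _ => (hA.hasGaussianLaw i j).integrable.mul_const _]
      refine Finset.sum_eq_zero fun j _ => ?_
      rw [integral_mul_const, (hA.law i j).integral_eq]
      simp
    rw [hmean]
    simp

end


/-! ### Nets of the sphere and passage from a net to all vectors -/

section Net

variable {E : Type*} [NormedAddCommGroup E] [NormedSpace ℝ E] [FiniteDimensional ℝ E]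

/-- Volume comparison: the balls of radius `δ/2` about the points are disjoint and lie in the ball
of radius `1 + δ/2`. -/
theorem card_le_of_separated_of_norm_le_one {s : Finset E} {δ : ℝ} (hδ : 0 < δ)
    (hs : ∀ c ∈ s, ‖c‖ ≤ 1) (h : ∀ c ∈ s, ∀ d ∈ s, c ≠ d → δ ≤ ‖c - d‖) :
    (s.card : ℝ) ≤ (1 + 2 / δ) ^ Module.finrank ℝ E := by
  borelize E
  let μ : Measure E := Measure.addHaar
  have hd : (s : Set E).PairwiseDisjoint fun c => Metric.ball (c : E) (δ / 2) := by
    intro c hc d hd hcd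
    apply Metric.ball_disjoint_ball
    rw [dist_eq_norm]
    linarith [h c hc d hd hcd]
  have hsub : (⋃ c ∈ s, Metric.ball (c : E) (δ / 2)) ⊆ Metric.ball (0 : E) (1 + δ / 2) := by
    refine Set.iUnion₂_subset fun x hx => Metric.ball_subset_ball' ?_
    rw [dist_zero_right]
    linarith [hs x hx]
  have hvol : (s.card : ENNReal) * ENNReal.ofReal ((δ / 2) ^ Module.finrank ℝ E) *
      μ (Metric.ball 0 1) ≤
      ENNReal.ofReal ((1 + δ / 2) ^ Module.finrank ℝ E) * μ (Metric.ball 0 1) := by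
    calc _ = μ (⋃ c ∈ s, Metric.ball (c : E) (δ / 2)) := by
          rw [measure_biUnion_finset hd fun c _ => measurableSet_ball]
          simp only [μ.addHaar_ball_of_pos _ (half_pos hδ), Finset.sum_const, nsmul_eq_mul,
            mul_assoc]
      _ ≤ μ (Metric.ball (0 : E) (1 + δ / 2)) := measure_mono hsub
      _ = _ := by simp only [μ.addHaar_ball_of_pos _ (by positivity : 0 < 1 + δ / 2)]
  have hcard := (ENNReal.mul_le_mul_iff_left
    (Metric.measure_ball_pos _ _ zero_lt_one).ne' measure_ball_lt_top.ne).1 hvol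
  have hreal := ENNReal.toReal_le_of_le_ofReal (by positivity) hcard
  rw [ENNReal.toReal_mul, ENNReal.toReal_natCast, ENNReal.toReal_ofReal (by positivity),
    ← le_div_iff₀ (by positivity), ← div_pow] at hreal
  rwa [show (1 + δ / 2) / (δ / 2) = 1 + 2 / δ by field_simp; ring] at hreal

/-- A `δ`-separated subset of the sphere of maximal cardinality is a net, since a point far from it
could be added. The packing bound ensures that the maximum exists. -/
theorem exists_finset_net_sphere {δ : ℝ} (hδ : 0 < δ) :
    ∃ N : Finset E, (∀ v ∈ N, ‖v‖ = 1) ∧ (N.card : ℝ) ≤ (1 + 2 / δ) ^ Module.finrank ℝ E ∧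
      ∀ u : E, ‖u‖ = 1 → ∃ v ∈ N, ‖u - v‖ ≤ δ := by
  classical
  let P : Finset E → Prop := fun s =>
    (∀ v ∈ s, ‖v‖ = 1) ∧ ∀ c ∈ s, ∀ d ∈ s, c ≠ d → δ ≤ ‖c - d‖
  have hcard : ∀ s, P s → (s.card : ℝ) ≤ (1 + 2 / δ) ^ Module.finrank ℝ E := fun s hs =>
    card_le_of_separated_of_norm_le_one hδ (fun c hc => (hs.1 c hc).le) hs.2
  let k := ⌊(1 + 2 / δ) ^ Module.finrank ℝ E⌋₊
  let Q : ℕ → Prop := fun j => ∃ s, P s ∧ s.card = j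
  have hQ0 : Q 0 := ⟨∅, by simp [P], rfl⟩
  obtain ⟨N, hN, hNcard⟩ := Nat.findGreatest_spec (P := Q) (Nat.zero_le k) hQ0
  refine ⟨N, hN.1, hcard N hN, fun u hu => ?_⟩
  by_contra! hfar
  have hu_notMem : u ∉ N := fun hmem => by
    have := hδ.trans (hfar u hmem)
    simp at this
  have hins : P (insert u N) := by
    constructor
    · intro v hv
      rcases Finset.mem_insert.1 hv with rfl | hv
      exacts [hu, hN.1 v hv]
    · intro c hc d hd hcd
      rcases Finset.mem_insert.1 hc with rfl | hc' <;> rcases Finset.mem_insert.1 hd with rfl | hd'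
      · exact absurd rfl hcd
      · exact (hfar d hd').le
      · rw [norm_sub_rev]; exact (hfar c hc').le
      · exact hN.2 c hc' d hd' hcd
  have hle : (insert u N).card ≤ Nat.findGreatest Q k :=
    Nat.le_findGreatest (Nat.le_floor (hcard _ hins)) ⟨_, hins, rfl⟩
  rw [Finset.card_insert_of_notMem hu_notMem] at hle
  omega

end Net

theorem opNorm_le_two_mul_of_net {E F : Type*} [NormedAddCommGroup E] [NormedSpace ℝ E]
    [NormedAddCommGroup F] [NormedSpace ℝ F]
    (L : E →L[ℝ] F) {N : Set E} {δ K : ℝ} (hδ : δ ≤ 1 / 2) (hK : 0 ≤ K)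
    (hnet : ∀ u : E, ‖u‖ = 1 → ∃ v ∈ N, ‖u - v‖ ≤ δ) (hN : ∀ v ∈ N, ‖L v‖ ≤ K) :
    ‖L‖ ≤ 2 * K := by
  suffices h : ‖L‖ ≤ K + ‖L‖ / 2 by linarith
  refine L.opNorm_le_of_unit_norm (by positivity) fun u hu => ?_
  obtain ⟨v, hv, huv⟩ := hnet u hu
  calc ‖L u‖ = ‖L v + L (u - v)‖ := by rw [← map_add]; congr 2; abel
    _ ≤ ‖L v‖ + ‖L (u - v)‖ := norm_add_le _ _
    _ ≤ K + ‖L‖ * (1 / 2) := by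
        gcongr
        · exact hN v hv
        · exact (L.le_opNorm _).trans (by gcongr; exact huv.trans hδ)
    _ = _ := by ring

theorem card_mul_sq_le_norm_sq {m : ℕ} (w : EuclideanSpace ℝ (Fin m)) {ε : ℝ} (hε : 0 ≤ ε) :
    (({i | ε ≤ |w i|} : Finset (Fin m)).card : ℝ) * ε ^ 2 ≤ ‖w‖ ^ 2 := by
  rw [EuclideanSpace.real_norm_sq_eq, ← nsmul_eq_mul, ← Finset.sum_const]
  refine (Finset.sum_le_sum fun i hi => ?_).trans
    (Finset.sum_le_sum_of_subset_of_nonneg (Finset.subset_univ _) fun i _ _ => sq_nonneg _)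
  rw [← sq_abs (w i)]
  have := (Finset.mem_filter.1 hi).2
  gcongr

/-- Normalize `u` to `e` and take `v` in the net near `e`. A coordinate of `L e` below `ε` is either
below `2ε` for `L v` or at least `ε` for `L (e - v)`; a Chebyshev count with `‖L (e - v)‖ ≤ K δ`
bounds the latter kind. -/
theorem card_abs_lt_le_of_net {E : Type*} [NormedAddCommGroup E] [NormedSpace ℝ E] {m : ℕ}
    (L : E →L[ℝ] EuclideanSpace ℝ (Fin m)) {N : Set E} {δ ε K a : ℝ} (hε : 0 < ε)
    (hL : ‖L‖ ≤ K) (hnet : ∀ u : E, ‖u‖ = 1 → ∃ v ∈ N, ‖u - v‖ ≤ δ)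
    (hN : ∀ v ∈ N, (({i | |L v i| < 2 * ε} : Finset (Fin m)).card : ℝ) ≤ a)
    {u : E} (hu : u ≠ 0) :
    (({i | |L u i| < ε * ‖u‖} : Finset (Fin m)).card : ℝ) ≤ a + (K * δ) ^ 2 / ε ^ 2 := by
  have hu' : 0 < ‖u‖ := norm_pos_iff.2 hu
  set e : E := ‖u‖⁻¹ • u
  have he : ‖e‖ = 1 := by simp [e, norm_smul, hu'.ne']
  have hue : ∀ i, L u i = ‖u‖ * L e i := fun i => by simp [e, hu'.ne']
  obtain ⟨v, hv, hev⟩ := hnet e he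
  have hsub : ({i | |L u i| < ε * ‖u‖} : Finset (Fin m)) ⊆
      ({i | |L v i| < 2 * ε} : Finset (Fin m)) ∪ ({i | ε ≤ |L (e - v) i|} : Finset (Fin m)) := by
    intro i hi
    simp only [Finset.mem_union, Finset.mem_filter, Finset.mem_univ, true_and] at hi ⊢
    by_contra! hcon
    rw [hue, abs_mul, abs_of_pos hu', mul_comm ε, mul_lt_mul_iff_right₀ hu'] at hi
    have h1 : L v i = L e i - L (e - v) i := by simp
    have h2 := abs_sub (L e i) (L (e - v) i)
    rw [← h1] at h2
    linarith
  have hw := card_mul_sq_le_norm_sq (L (e - v)) hε.le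
  have hw2 : ‖L (e - v)‖ ≤ K * δ :=
    (L.le_opNorm _).trans (mul_le_mul hL hev (norm_nonneg _) ((norm_nonneg _).trans hL))
  have hw3 : (({i | ε ≤ |L (e - v) i|} : Finset (Fin m)).card : ℝ) ≤ (K * δ) ^ 2 / ε ^ 2 := by
    rw [le_div_iff₀ (by positivity)]
    exact hw.trans (by gcongr)
  calc _ ≤ ((_ ∪ _ : Finset (Fin m)).card : ℝ) := by exact_mod_cast Finset.card_le_card hsub
    _ ≤ (Finset.card _ : ℝ) + (Finset.card _ : ℝ) := by exact_mod_cast Finset.card_union_le _ _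
    _ ≤ _ := add_le_add (hN v hv) hw3

/-! ### Deterministic criterion for the range property -/

theorem abs_abs_sub_abs_eq_min (a b : ℝ) : |(|a| - |b|)| = min |a - b| |a + b| := by
  grind

theorem l1Norm_restrictTo {m : ℕ} (v : Fin m → ℝ) (T : Finset (Fin m)) :
    l1Norm (restrictTo v T) = ∑ i ∈ T, |v i| := by
  simp [l1Norm, restrictTo, apply_ite abs, Finset.sum_ite_mem]

theorem sum_min_le_of_norm_le {E : Type*} [NormedAddCommGroup E] [NormedSpace ℝ E] {m : ℕ}
    (L : E →L[ℝ] EuclideanSpace ℝ (Fin m)) {ε K s : ℝ} (hε : 0 ≤ ε) (hs : s ≤ 1 / 4)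
    (hKs : K * √s ≤ ε / 8)
    (hL : ‖L‖ ≤ K * √m)
    (hcard : ∀ u : E, u ≠ 0 → (({i | |L u i| < ε * ‖u‖} : Finset (Fin m)).card : ℝ) ≤ m / 4)
    {u v : E} (hu : u ≠ 0) (huv : ‖u‖ ≤ ‖v‖) {T : Finset (Fin m)} (hT : (T.card : ℝ) ≤ s * m) :
    ∑ i ∈ T, min |L u i| |L v i| ≤ 1 / 2 * ∑ i ∈ Tᶜ, min |L u i| |L v i| := by
  classical
  have hu' : 0 < ‖u‖ := norm_pos_iff.2 hu
  have hv : v ≠ 0 := norm_pos_iff.1 (hu'.trans_le huv)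
  have hupper : ∑ i ∈ T, min |L u i| |L v i| ≤ ε / 8 * m * ‖u‖ := by
    have h1 : (∑ i ∈ T, |L u i|) ^ 2 ≤ (s * m) * ‖L u‖ ^ 2 := by
      refine sq_sum_le_card_mul_sum_sq.trans ?_
      rw [EuclideanSpace.real_norm_sq_eq]
      simp only [sq_abs]
      refine mul_le_mul hT ?_ (Finset.sum_nonneg fun i _ => sq_nonneg _)
        ((Nat.cast_nonneg _).trans hT)
      exact Finset.sum_le_sum_of_subset_of_nonneg (Finset.subset_univ _) fun i _ _ => sq_nonneg _
    calc ∑ i ∈ T, min |L u i| |L v i| ≤ ∑ i ∈ T, |L u i| :=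
          Finset.sum_le_sum fun i _ => min_le_left _ _
      _ ≤ √((s * m) * ‖L u‖ ^ 2) := Real.le_sqrt_of_sq_le h1
      _ = √s * √m * ‖L u‖ := by
          rw [Real.sqrt_mul' _ (sq_nonneg _), Real.sqrt_mul' _ (Nat.cast_nonneg m),
            Real.sqrt_sq (norm_nonneg _)]
      _ ≤ √s * √m * (K * √m * ‖u‖) := by
          gcongr
          exact (L.le_opNorm u).trans (by gcongr)
      _ = K * √s * (√m * √m) * ‖u‖ := by ring
      _ ≤ ε / 8 * m * ‖u‖ := by
          rw [Real.mul_self_sqrt (Nat.cast_nonneg m)]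
          gcongr
  have hlower : ε / 4 * m * ‖u‖ ≤ ∑ i ∈ Tᶜ, min |L u i| |L v i| := by
    set Bu : Finset (Fin m) := {i | |L u i| < ε * ‖u‖}
    set Bv : Finset (Fin m) := {i | |L v i| < ε * ‖v‖}
    -- `T`, `Bu` and `Bv` each have at most `m/4` elements, so at least `m/4` indices lie outside
    -- all three.
    have hsub : Finset.univ ⊆ (Tᶜ \ (Bu ∪ Bv)) ∪ (T ∪ (Bu ∪ Bv)) := by
      intro i _
      simp only [Finset.mem_union, Finset.mem_sdiff, Finset.mem_compl]
      tauto
    have hc : (m : ℝ) ≤ (Tᶜ \ (Bu ∪ Bv)).card + (T.card + (Bu.card + Bv.card)) := by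
      have h := (Finset.card_le_card hsub).trans ((Finset.card_union_le _ _).trans
        (Nat.add_le_add_left ((Finset.card_union_le _ _).trans
          (Nat.add_le_add_left (Finset.card_union_le _ _) _)) _))
      rw [Finset.card_univ, Fintype.card_fin] at h
      exact_mod_cast h
    have hBu := hcard u hu
    have hBv := hcard v hv
    have hsm : s * m ≤ 1 / 4 * m := by gcongr
    have hcount : (m : ℝ) / 4 ≤ (Tᶜ \ (Bu ∪ Bv)).card := by linarith
    calc ε / 4 * m * ‖u‖ = m / 4 * (ε * ‖u‖) := by ring
      _ ≤ (Tᶜ \ (Bu ∪ Bv)).card * (ε * ‖u‖) := by gcongr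
      _ = ∑ _i ∈ Tᶜ \ (Bu ∪ Bv), ε * ‖u‖ := by rw [Finset.sum_const, nsmul_eq_mul]
      _ ≤ ∑ i ∈ Tᶜ \ (Bu ∪ Bv), min |L u i| |L v i| := by
          refine Finset.sum_le_sum fun i hi => ?_
          simp only [Bu, Bv, Finset.mem_union, Finset.mem_sdiff, Finset.mem_filter,
            Finset.mem_univ, true_and, not_or, not_lt] at hi
          -- `‖u‖ ≤ ‖v‖` turns the threshold `ε‖v‖` into `ε‖u‖`.
          refine le_min hi.2.1 (le_trans ?_ hi.2.2)
          gcongr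
      _ ≤ ∑ i ∈ Tᶜ, min |L u i| |L v i| :=
          Finset.sum_le_sum_of_subset_of_nonneg Finset.sdiff_subset
            fun i _ _ => le_min (abs_nonneg _) (abs_nonneg _)
  linarith

/-- The continuous linear map between Euclidean spaces given by a rectangular matrix. -/
noncomputable def euclideanCLM {m n : ℕ} (A : Matrix (Fin m) (Fin n) ℝ) :
    EuclideanSpace ℝ (Fin n) →L[ℝ] EuclideanSpace ℝ (Fin m) :=
  LinearMap.toContinuousLinearMap (Matrix.toLpLin 2 2 A)

theorem euclideanCLM_apply {m n : ℕ} (A : Matrix (Fin m) (Fin n) ℝ)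
    (u : EuclideanSpace ℝ (Fin n)) (i : Fin m) :
    euclideanCLM A u i = A.mulVec u i := rfl

theorem absoluteRangeProperty_one_of_card_le {m n : ℕ} (A : Matrix (Fin m) (Fin n) ℝ)
    {ε K s : ℝ} (hε : 0 ≤ ε) (hs : s ≤ 1 / 4) (hKs : K * √s ≤ ε / 8)
    (hL : ‖euclideanCLM A‖ ≤ K * √m)
    (hcard : ∀ u, u ≠ 0 →
      (({i | |euclideanCLM A u i| < ε * ‖u‖} : Finset (Fin m)).card : ℝ) ≤ m / 4) :
    AbsoluteRangeProperty 1 A (s * m) (1 / 2) := by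
  intro x y T hT
  set u := WithLp.toLp 2 (x - y) with hu_def
  set v := WithLp.toLp 2 (x + y) with hv_def
  have hmin : ∀ i, |(absPow 1 (A.mulVec x) - absPow 1 (A.mulVec y)) i| =
      min |euclideanCLM A u i| |euclideanCLM A v i| := by
    intro i
    simp only [absPow, pow_one, Pi.sub_apply, abs_abs_sub_abs_eq_min, euclideanCLM_apply, u, v,
      Matrix.mulVec_sub, Matrix.mulVec_add, Pi.add_apply]
  simp only [l1Norm_restrictTo, hmin]
  by_cases hu : u = 0
  · simp [hu]
  by_cases hv : v = 0
  · simp [hv]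
  rcases le_total ‖u‖ ‖v‖ with huv | huv
  · exact sum_min_le_of_norm_le _ hε hs hKs hL hcard hu huv hT
  · simp only [min_comm |euclideanCLM A u _|]
    exact sum_min_le_of_norm_le _ hε hs hKs hL hcard hv huv hT


/-! ### Tail bounds for one vector and the union bound -/

section

variable {Ω : Type*} [MeasurableSpace Ω] {μ : Measure Ω} {m n : ℕ}
  {A : Ω → Matrix (Fin m) (Fin n) ℝ}

theorem AssumptionG.measure_le_norm_sq (hA : AssumptionG μ A) {v : EuclideanSpace ℝ (Fin n)}
    (hv : ‖v‖ = 1) :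
    μ {ω | 8 * (m : ℝ) ≤ ‖euclideanCLM (A ω) v‖ ^ 2} ≤ ENNReal.ofReal (Real.exp (-m)) := by
  have hv2 : ∑ j, v j ^ 2 = 1 := by rw [← EuclideanSpace.real_norm_sq_eq, hv, one_pow]
  have h := measure_le_sum_of_iIndepFun (hA.iIndepFun_mulVec v) (hA.hasLaw_mulVec hv2)
    -- Threshold `2m` against log-moment `m` leaves `exp(-m)`; after multiplying by 4 the threshold
    -- is `8m`.
    (f := fun x => x ^ 2 / 4) (by fun_prop) (2 * m) lintegral_exp_sq_div_four_gaussianReal_le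
  convert h using 2
  · ext ω
    simp only [Set.mem_ofPred_eq, ← Finset.sum_div, EuclideanSpace.real_norm_sq_eq,
      euclideanCLM_apply]
    constructor <;> intro h <;> linarith
  · rw [Fintype.card_fin]
    congr 1; ring

theorem AssumptionG.measure_le_card_abs_lt (hA : AssumptionG μ A)
    {v : EuclideanSpace ℝ (Fin n)} (hv : ‖v‖ = 1) {t : ℝ} (ht : Real.exp 16 * (2 * t) ≤ 1) :
    μ {ω | (m : ℝ) / 8 ≤ ({i | |euclideanCLM (A ω) v i| < t} : Finset (Fin m)).card} ≤
      ENNReal.ofReal (Real.exp (-m)) := by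
  have hv2 : ∑ j, v j ^ 2 = 1 := by rw [← EuclideanSpace.real_norm_sq_eq, hv, one_pow]
  have h := measure_le_sum_of_iIndepFun (hA.iIndepFun_mulVec v) (hA.hasLaw_mulVec hv2)
    -- The weight 16 makes `m/8` small coordinates reach the same threshold `2m`.
    (f := fun x => if |x| < t then 16 else 0)
    (Measurable.ite (measurableSet_lt (by fun_prop) (by fun_prop)) (by fun_prop) (by fun_prop))
    (2 * m) (lintegral_exp_indicator_gaussianReal_le ht)
  convert h using 2
  · ext ω
    have hsum : ∑ i, (if |(A ω).mulVec v i| < t then (16 : ℝ) else 0) =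
        ({i | |euclideanCLM (A ω) v i| < t} : Finset (Fin m)).card * 16 := by
      rw [Finset.card_filter, Nat.cast_sum, Finset.sum_mul]
      refine Finset.sum_congr rfl fun i _ => ?_
      rw [euclideanCLM_apply]
      split_ifs <;> norm_num
    simp only [Set.mem_ofPred_eq, hsum]
    constructor <;> intro h <;> linarith
  · rw [Fintype.card_fin]
    congr 1; ring

theorem AssumptionG.measure_not_absoluteRangeProperty_le (hA : AssumptionG μ A) {ε : ℝ}
    (hε : 0 < ε) (hε' : Real.exp 16 * (2 * (2 * ε)) ≤ 1)
    (hmn : 2 * Real.log (1 + 2 / (ε / 20)) * n < m) :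
    μ {ω | ¬ AbsoluteRangeProperty 1 (A ω) ((ε / 48) ^ 2 * m) (1 / 2)} ≤
      ENNReal.ofReal (2 * Real.exp (-(1 / 2) * m)) := by
  have hε1 : ε ≤ 1 := by
    have := Real.add_one_le_exp (16 : ℝ)
    nlinarith
  obtain ⟨N, hN1, hNcard, hNnet⟩ :=
    exists_finset_net_sphere (E := EuclideanSpace ℝ (Fin n)) (by positivity : 0 < ε / 20)
  have hcard : (N.card : ℝ) ≤ Real.exp (m / 2) := by
    refine hNcard.trans ?_
    rw [finrank_euclideanSpace_fin, ← Real.rpow_natCast, Real.rpow_def_of_pos (by positivity),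
      Real.exp_le_exp]
    linarith
  let B₁ : EuclideanSpace ℝ (Fin n) → Set Ω := fun v =>
    {ω | 8 * (m : ℝ) ≤ ‖euclideanCLM (A ω) v‖ ^ 2}
  let B₂ : EuclideanSpace ℝ (Fin n) → Set Ω := fun v =>
    {ω | (m : ℝ) / 8 ≤ ({i | |euclideanCLM (A ω) v i| < 2 * ε} : Finset (Fin m)).card}
  have hsub : {ω | ¬ AbsoluteRangeProperty 1 (A ω) ((ε / 48) ^ 2 * m) (1 / 2)} ⊆
      ⋃ v ∈ N, B₁ v ∪ B₂ v := by
    intro ω hω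
    by_contra hgood
    simp only [Set.mem_iUnion, Set.mem_union, Set.mem_ofPred_eq, not_exists, not_or, not_le, B₁,
      B₂] at hgood
    apply hω
    -- On the net `‖Av‖² < 8m ≤ (3√m)²`; passing to the sphere doubles `3√m`.
    have hL : ‖euclideanCLM (A ω)‖ ≤ 6 * √m := by
      rw [show (6 : ℝ) * √m = 2 * (3 * √m) by ring]
      refine opNorm_le_two_mul_of_net _ (N := N) (δ := ε / 20) (by linarith) (by positivity)
        hNnet fun v hv => ?_
      refine (sq_le_sq₀ (norm_nonneg _) (by positivity)).1 ?_
      rw [mul_pow, Real.sq_sqrt (Nat.cast_nonneg m)]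
      linarith [(hgood v hv).1, (Nat.cast_nonneg m : (0 : ℝ) ≤ m)]
    refine absoluteRangeProperty_one_of_card_le (A ω) hε.le (K := 6) ?_ ?_ hL ?_
    · nlinarith
    -- `s = (ε/48)²` is chosen so that `6√s = ε/8`.
    · rw [Real.sqrt_sq (by positivity)]
      linarith
    · intro u hu
      refine (card_abs_lt_le_of_net _ hε hL hNnet (fun v hv => (hgood v hv).2.le) hu).trans ?_
      rw [mul_pow, mul_pow, Real.sq_sqrt (Nat.cast_nonneg m)]
      -- The mesh `ε/20` is fine enough that `m/8 + 9m/100 ≤ m/4`.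
      have : (6 : ℝ) ^ 2 * m * (ε / 20) ^ 2 / ε ^ 2 = 9 / 100 * m := by
        field_simp; ring
      rw [this]
      linarith [(Nat.cast_nonneg m : (0 : ℝ) ≤ m)]
  calc _ ≤ μ (⋃ v ∈ N, B₁ v ∪ B₂ v) := measure_mono hsub
    _ ≤ ∑ v ∈ N, μ (B₁ v ∪ B₂ v) := measure_biUnion_finset_le _ _
    _ ≤ ∑ v ∈ N, ENNReal.ofReal (2 * Real.exp (-m)) := by
        refine Finset.sum_le_sum fun v hv => (measure_union_le _ _).trans ?_
        rw [two_mul, ENNReal.ofReal_add (Real.exp_pos _).le (Real.exp_pos _).le]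
        exact add_le_add (hA.measure_le_norm_sq (hN1 v hv))
          (hA.measure_le_card_abs_lt (hN1 v hv) hε')
    _ = ENNReal.ofReal (N.card * (2 * Real.exp (-m))) := by
        rw [Finset.sum_const, nsmul_eq_mul, ENNReal.ofReal_mul (Nat.cast_nonneg _),
          ENNReal.ofReal_natCast]
    _ ≤ ENNReal.ofReal (Real.exp (m / 2) * (2 * Real.exp (-m))) := by gcongr
    _ = _ := by
        rw [mul_left_comm, ← Real.exp_add]
        ring_nf

end

end RobustPhaseRetrieval

/-! ### Choice of constants and conclusion -/

theorem lemma4p8 :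
    ∃ c₀ c₁ C s ψ : ℝ, 0 < c₀ ∧ 0 < c₁ ∧ 0 < C ∧ s ∈ Set.Ioo (0 : ℝ) 1 ∧ ψ ∈ Set.Ioo (0 : ℝ) 1 ∧
      (∀ (m n : ℕ), c₀ * (n : ℝ) < (m : ℝ) →
        ∀ (Ω : Type u) [MeasurableSpace Ω] (μ : Measure Ω) [IsProbabilityMeasure μ]
          (A : Ω → Matrix (Fin m) (Fin n) ℝ), RobustPhaseRetrieval.AssumptionG μ A →
          1 - C * Real.exp (-c₁ * (m : ℝ)) ≤
            μ.real {ω | RobustPhaseRetrieval.AbsoluteRangeProperty 1 (A ω) (s * (m : ℝ)) ψ}) ∧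
      (∀ δ : ℝ, 0 < δ → ∃ M : ℕ, ∀ (m n : ℕ), M ≤ m → c₀ * (n : ℝ) < (m : ℝ) →
        ∀ (Ω : Type u) [MeasurableSpace Ω] (μ : Measure Ω) [IsProbabilityMeasure μ]
          (A : Ω → Matrix (Fin m) (Fin n) ℝ), RobustPhaseRetrieval.AssumptionG μ A →
          1 - δ ≤
            μ.real {ω | RobustPhaseRetrieval.AbsoluteRangeProperty 1 (A ω) (s * (m : ℝ)) ψ}) := by
  obtain ⟨ε, hε, hε1, hε'⟩ : ∃ ε : ℝ, 0 < ε ∧ ε ≤ 1 ∧ Real.exp 16 * (2 * (2 * ε)) ≤ 1 := by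
    -- The largest `ε` for which the small-coordinate bound applies at level `t = 2ε`.
    refine ⟨(4 * Real.exp 16)⁻¹, by positivity, ?_, le_of_eq (by field_simp; norm_num)⟩
    exact inv_le_one_of_one_le₀ (by linarith [Real.add_one_le_exp (16 : ℝ)])
  have hmain : ∀ (m n : ℕ), 2 * Real.log (1 + 2 / (ε / 20)) * (n : ℝ) < (m : ℝ) →
      ∀ (Ω : Type u) [MeasurableSpace Ω] (μ : Measure Ω) [IsProbabilityMeasure μ]
        (A : Ω → Matrix (Fin m) (Fin n) ℝ), RobustPhaseRetrieval.AssumptionG μ A →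
        1 - 2 * Real.exp (-(1 / 2) * (m : ℝ)) ≤ μ.real
          {ω | RobustPhaseRetrieval.AbsoluteRangeProperty 1 (A ω) ((ε / 48) ^ 2 * m) (1 / 2)} := by
    intro m n hmn Ω _ μ _ A hA
    set S := {ω | RobustPhaseRetrieval.AbsoluteRangeProperty 1 (A ω) ((ε / 48) ^ 2 * m) (1 / 2)}
    have hbad : μ.real Sᶜ ≤ 2 * Real.exp (-(1 / 2) * (m : ℝ)) :=
      ENNReal.toReal_le_of_le_ofReal (by positivity)
        (hA.measure_not_absoluteRangeProperty_le hε hε' hmn)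
    -- Subadditivity suffices here, so measurability of `S` is not needed.
    have hcover : (1 : ℝ) ≤ μ.real S + μ.real Sᶜ := by
      rw [← probReal_univ (μ := μ), ← Set.union_compl_self S]
      exact measureReal_union_le _ _
    linarith
  refine ⟨2 * Real.log (1 + 2 / (ε / 20)), 1 / 2, 2, (ε / 48) ^ 2, 1 / 2, ?_, by norm_num,
    by norm_num, ⟨by positivity, by nlinarith⟩, ⟨by norm_num, by norm_num⟩, hmain, ?_⟩
  · have : 0 < Real.log (1 + 2 / (ε / 20)) := Real.log_pos (by simp [hε])
    positivity
  · intro δ hδ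
    have hlim : Filter.Tendsto (fun m : ℕ => 2 * Real.exp (-(1 / 2) * (m : ℝ))) Filter.atTop
        (nhds 0) := by
      have h := (Real.tendsto_exp_atBot.comp
        ((tendsto_natCast_atTop_atTop (R := ℝ)).const_mul_atTop_of_neg
          (by norm_num : (-(1 / 2) : ℝ) < 0))).const_mul (2 : ℝ)
      simpa [Function.comp_def] using h
    obtain ⟨M, hM⟩ := Filter.eventually_atTop.1 (hlim.eventually (gt_mem_nhds hδ))
    refine ⟨M, fun m n hm hmn Ω _ μ _ A hA => ?_⟩
    linarith [hmain m n hmn Ω μ A hA, hM m hm]
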